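/- Let $0\le z_0<z_1$, let $u$ be continuous and positive on $[z_0,z_1]$, let $\psi$ be integrable on $(z_0,z_1)$, and let $\alpha_0,\alpha_1,\beta_0,\beta_1,c_1,c_2\in\mathbb R$ with $\alpha_0^2+\alpha_1^2>0$ and $\beta_0^2+\beta_1^2>0$. Let $\bar\theta\in C^1[z_0,z_1]$ satisfy $$(u\bar\theta')'=0\ \text{ on }(z_0,z_1),\qquad \alpha_0\bar\theta(z_0)-\alpha_1\bar\theta'(z_0)=c_1,\qquad \beta_0\bar\theta(z_1)+\beta_1\bar\theta'(z_1)=c_2 .$$ Let $\lambda_0<\lambda_1<\cdots$ be all the (real) eigenvalues, in increasing order, of the Sturm--Liouville problem $$-(uy')'=\lambda y\ \text{ on }(z_0,z_1),\qquad \alpha_0y(z_0)-\alpha_1y'(z_0)=0,\qquad \beta_0y(z_1)+\beta_1y'(z_1)=0,$$ and let $y_n\in C^1[z_0,z_1]$, $y_n\not\equiv0$, be an eigenfunction for $\lambda_n$. Put $$a_n=\frac{\int_{z_0}^{z_1}(\psi-\bar\theta)\,y_n\,dz}{\int_{z_0}^{z_1}y_n^2\,dz},\qquad \theta(z,t)=\bar\theta(z)+\sum_{n=0}^\infty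 a_n\,y_n(z)\,e^{-\lambda_nt}\qquad(z_0\le z\le z_1,\ t>0).$$ Then the following hold. 1. If $\lambda_n>0$ for all $n$, then $\theta(z,t)\to\bar\theta(z)$ as $t\to\infty$ for every $z\in[z_0,z_1]$. 2. For every $\tau>0$ the series for $\theta(\cdot,\tau)$ converges absolutely at every point of $[z_0,z_1]$, and uniformly on $[z_0,z_1]$; hence $\theta(\cdot,\tau)$ is continuous on $[z_0,z_1]$. 3. For large $t$, $\theta$ is approximated by $\bar\theta+a_0y_0e^{-\lambda_0t}$, uniformly in $z$: for every $t_0>0$ there is a constant $C$ such that $$\left|\theta(z,t)-\bar\theta(z)-a_0y_0(z)e^{-\lambda_0t}\right|\le C e^{-\lambda_1t}\qquad\text{for all } t\ge t_0,\ z\in[z_0,z_1],$$ and $e^{\lambda_0t}\left(\theta(z,t)-\bar\theta(z)\right)\to a_0y_0(z)$ as $t\to\infty$, uniformly in $z\in[z_0,z_1]$. -/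

import Mathlib

open Set Filter Topology

noncomputable section

/-- Data of the initial-boundary value problem
`θ_t = (u θ_z)_z` for `z₀ < z < z₁`, `t > 0`, with `θ(z, 0) = ψ(z)` and Robin conditions
`a₀ θ - a₁ θ_z = c₁` at `z₀`, `b₀ θ + b₁ θ_z = c₂` at `z₁`. The profile `u` is continuous and
positive on `[z₀, z₁]` (regular problem), and the initial datum `ψ` is integrable. -/
structure DiffusionIBVP where
  z₀ : ℝ
  z₁ : ℝ
  u : ℝ → ℝ
  ψ : ℝ → ℝ
  a₀ : ℝ
  a₁ : ℝ
  b₀ : ℝ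
  b₁ : ℝ
  c₁ : ℝ
  c₂ : ℝ
  z₀_nonneg : 0 ≤ z₀
  z₀_lt_z₁ : z₀ < z₁
  u_continuousOn : ContinuousOn u (Icc z₀ z₁)
  u_pos : ∀ z ∈ Icc z₀ z₁, 0 < u z
  ψ_integrable : MeasureTheory.IntegrableOn ψ (Ioo z₀ z₁)
  a_ne : 0 < a₀ ^ 2 + a₁ ^ 2
  b_ne : 0 < b₀ ^ 2 + b₁ ^ 2

namespace DiffusionIBVP

variable (P : DiffusionIBVP)

/-- The closed interval `[z₀, z₁]`. -/
def interval : Set ℝ := Icc P.z₀ P.z₁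

/-- The derivative on `[z₀, z₁]`, one-sided at the end points. -/
def D (f : ℝ → ℝ) (z : ℝ) : ℝ := derivWithin f P.interval z

/-- `f` is a steady state: a classical solution, `C¹` up to the boundary, of `(u f')' = 0` on
`(z₀, z₁)` with the inhomogeneous Robin boundary conditions. -/
structure IsSteadyState (f : ℝ → ℝ) : Prop where
  contDiffOn : ContDiffOn ℝ 1 f P.interval
  ode : ∀ z ∈ Ioo P.z₀ P.z₁, HasDerivAt (fun x => P.u x * P.D f x) 0 z
  bc₀ : P.a₀ * f P.z₀ - P.a₁ * P.D f P.z₀ = P.c₁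
  bc₁ : P.b₀ * f P.z₁ + P.b₁ * P.D f P.z₁ = P.c₂

/-- `y` is an eigenfunction with eigenvalue `μ` of the Sturm-Liouville problem
`-(u y')' = μ y` on `(z₀, z₁)` with the homogeneous Robin boundary conditions. -/
structure IsEigenfunction (μ : ℝ) (y : ℝ → ℝ) : Prop where
  nontrivial : ∃ z ∈ P.interval, y z ≠ 0
  contDiffOn : ContDiffOn ℝ 1 y P.interval
  ode : ∀ z ∈ Ioo P.z₀ P.z₁, HasDerivAt (fun x => P.u x * P.D y x) (-(μ * y z)) z
  bc₀ : P.a₀ * y P.z₀ - P.a₁ * P.D y P.z₀ = 0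
  bc₁ : P.b₀ * y P.z₁ + P.b₁ * P.D y P.z₁ = 0

/-- `lam 0 < lam 1 < ⋯` lists all the eigenvalues in increasing order, and `y n` is an
eigenfunction for the eigenvalue `lam n`. -/
structure IsEigensystem (lam : ℕ → ℝ) (y : ℕ → ℝ → ℝ) : Prop where
  strictMono : StrictMono lam
  eigen : ∀ n, P.IsEigenfunction (lam n) (y n)
  exhaustive : ∀ (μ : ℝ) (w : ℝ → ℝ), P.IsEigenfunction μ w → ∃ n, μ = lam n

/-- The coefficient `∫ (ψ - θbar) y / ∫ y²` of the initial perturbation along `y`. -/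
def coeff (θbar : ℝ → ℝ) (y : ℝ → ℝ) : ℝ :=
  (∫ z in P.z₀..P.z₁, (P.ψ z - θbar z) * y z) / ∫ z in P.z₀..P.z₁, y z ^ 2

/-- The `n`-th term of the perturbation series. -/
def term (θbar : ℝ → ℝ) (lam : ℕ → ℝ) (y : ℕ → ℝ → ℝ) (n : ℕ) (z t : ℝ) : ℝ :=
  P.coeff θbar (y n) * y n z * Real.exp (-(lam n * t))

/-- The series solution: steady state plus the sum of the perturbation series. -/
def theta (θbar : ℝ → ℝ) (lam : ℕ → ℝ) (y : ℕ → ℝ → ℝ) (z t : ℝ) : ℝ :=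
  θbar z + ∑' n, P.term θbar lam y n z t

end DiffusionIBVP

end

/-!
The series is handled by dominated summation. What has to be shown is that the coefficients
`a n * y n z` are bounded, uniformly in `z`, by a sequence which stays summable against
`exp (-(lam n * τ))` for every `τ > 0`. Neither asymptotics of the eigenvalues nor a Green function
is needed: both the growth of the eigenvalues and the sup norms of the eigenfunctions are controlled
by one inequality of Bessel type.

The energy form `∫ (-(u f')') f + K ∫ f ^ 2` dominates `f z ^ 2` for all `f` satisfying the boundary
conditions, if `K` is large enough (`exists_sq_le_energy`). So point evaluation at `z` is bounded in
the energy norm, with a bound independent of `z`. The eigenfunctions are orthogonal for the energy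
form, with energies `(lam n + K) * ∫ y n ^ 2`, so Bessel's inequality for that functional reads
`∑ y n z ^ 2 / ((lam n + K) * ∫ y n ^ 2) ≤ C` (`exists_sum_sq_div_le`). It has two consequences
(`exists_bound`). Integration over `z` gives `∑ 1 / (lam n + K) ≤ C * (z₁ - z₀)`, and a single term
gives `y n z ^ 2 ≤ C * (lam n + K) * ∫ y n ^ 2`. As `ψ - θbar` is integrable, the latter yields
`|a n * y n z| ≤ M * (lam n + K)`, and `(lam n + K) ^ 2 * exp (-(lam n * τ))` is bounded in `n`, so
that the terms of the series are dominated by a multiple of `1 / (lam n + K)` (`exists_majorant`).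

Uniform convergence and continuity follow by the Weierstrass test. Since `lam` is increasing, the
tail from index `k` on is `O(exp (-(lam k * t)))` uniformly in `z` (`exists_tail_le`), and the cases
`k = 0` and `k = 1` give the large-time statements.
-/

namespace DiffusionIBVP

/-! ### A pointwise interpolation inequality -/

/-- The square of a `C¹` function is controlled pointwise by a small multiple of `∫ f'²` and a large
multiple of `∫ f²`: compare `f z ^ 2` with the minimum of `f ^ 2`, which is at most its mean. -/
theorem sq_le_integral_sq_deriv_add {a b : ℝ} (hab : a < b) {f v : ℝ → ℝ}
    (hf : ContinuousOn f (Icc a b)) (hv : ContinuousOn v (Icc a b))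
    (hd : ∀ z ∈ Ioo a b, HasDerivAt f (v z) z) {ε : ℝ} (hε : 0 < ε) {z : ℝ} (hz : z ∈ Icc a b) :
    f z ^ 2 ≤ ε * (∫ x in a..b, v x ^ 2) + (1 / ε + 1 / (b - a)) * ∫ x in a..b, f x ^ 2 := by
  have hba : 0 < b - a := sub_pos.2 hab
  have hv2 : IntervalIntegrable (fun x => ε * v x ^ 2) MeasureTheory.volume a b :=
    ContinuousOn.intervalIntegrable_of_Icc hab.le (by fun_prop)
  have hf2 : IntervalIntegrable (fun x => f x ^ 2) MeasureTheory.volume a b :=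
    ContinuousOn.intervalIntegrable_of_Icc hab.le (by fun_prop)
  have hf2' : IntervalIntegrable (fun x => 1 / ε * f x ^ 2) MeasureTheory.volume a b :=
    hf2.const_mul _
  have hh : IntervalIntegrable (fun x => ε * v x ^ 2 + 1 / ε * f x ^ 2)
      MeasureTheory.volume a b := hv2.add hf2'
  have hhnn : ∀ x, 0 ≤ ε * v x ^ 2 + 1 / ε * f x ^ 2 := fun x => by positivity
  have hosc : ∀ p q, p ≤ q → p ∈ Icc a b → q ∈ Icc a b →
      |f q ^ 2 - f p ^ 2| ≤ ∫ x in a..b, (ε * v x ^ 2 + 1 / ε * f x ^ 2) := by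
    intro p q hpq hp hq
    have hsub : Icc p q ⊆ Icc a b := Icc_subset_Icc hp.1 hq.2
    have hf' := hf.mono hsub
    have hv' := hv.mono hsub
    have hftc : ∫ x in p..q, 2 * f x * v x = f q ^ 2 - f p ^ 2 := by
      refine intervalIntegral.integral_eq_sub_of_hasDerivAt_of_le (f := fun x => f x ^ 2) hpq
        (by fun_prop) (fun x hx => ?_)
        (ContinuousOn.intervalIntegrable_of_Icc hpq (by fun_prop))
      simpa using (hd x (Ioo_subset_Ioo hp.1 hq.2 hx)).fun_pow 2
    have hint : IntervalIntegrable (fun x => ε * v x ^ 2 + 1 / ε * f x ^ 2)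
        MeasureTheory.volume p q :=
      ContinuousOn.intervalIntegrable_of_Icc hpq (by fun_prop)
    rw [← hftc, ← Real.norm_eq_abs]
    refine (intervalIntegral.norm_integral_le_of_norm_le hpq
      (Eventually.of_forall fun x _ => ?_) hint).trans
      (intervalIntegral.integral_mono_interval hp.1 hpq hq.2
        (Eventually.of_forall hhnn) hh)
    have key : ε * v x ^ 2 + 1 / ε * f x ^ 2 - 2 * (|f x| * |v x|)
        = 1 / ε * (ε * |v x| - |f x|) ^ 2 := by
      rw [← sq_abs (v x), ← sq_abs (f x)]
      field_simp
      ring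
    have : 0 ≤ 1 / ε * (ε * |v x| - |f x|) ^ 2 := by positivity
    rw [Real.norm_eq_abs, abs_mul, abs_mul, abs_two]
    linarith
  obtain ⟨w, hw, hmin⟩ := isCompact_Icc.exists_isMinOn (nonempty_Icc.2 hab.le)
    (f := fun x => f x ^ 2) (by fun_prop)
  have hmean : f w ^ 2 ≤ 1 / (b - a) * ∫ x in a..b, f x ^ 2 := by
    have h := intervalIntegral.integral_mono_on hab.le
      (intervalIntegrable_const (c := f w ^ 2)) hf2 (fun x hx => hmin hx)
    rw [intervalIntegral.integral_const, smul_eq_mul] at h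
    rw [one_div, ← div_eq_inv_mul, le_div_iff₀ hba]
    linarith
  have hdiff : f z ^ 2 - f w ^ 2 ≤ ∫ x in a..b, (ε * v x ^ 2 + 1 / ε * f x ^ 2) := by
    rcases le_total w z with h | h
    · exact (le_abs_self _).trans (hosc w z h hw hz)
    · rw [← neg_sub]
      exact (neg_le_abs _).trans (hosc z w h hz hw)
  rw [intervalIntegral.integral_add hv2 hf2', intervalIntegral.integral_const_mul,
    intervalIntegral.integral_const_mul] at hdiff
  linarith

/-! ### Green's identities and coercivity -/

variable (P : DiffusionIBVP)

/-- `f` lies in the domain of the Sturm-Liouville operator: `v` is its derivative, the operator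
maps it to `g = -(u v)'`, and it satisfies the homogeneous Robin conditions. The derivative is a
separate function, so that linear combinations need no computation with one-sided derivatives. -/
structure InDomain (f v g : ℝ → ℝ) : Prop where
  cont : ContinuousOn f (Icc P.z₀ P.z₁)
  cont_deriv : ContinuousOn v (Icc P.z₀ P.z₁)
  cont_image : ContinuousOn g (Icc P.z₀ P.z₁)
  hasDerivAt : ∀ z ∈ Ioo P.z₀ P.z₁, HasDerivAt f (v z) z
  ode : ∀ z ∈ Ioo P.z₀ P.z₁, HasDerivAt (fun x => P.u x * v x) (-(g z)) z
  bc₀ : P.a₀ * f P.z₀ - P.a₁ * v P.z₀ = 0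
  bc₁ : P.b₀ * f P.z₁ + P.b₁ * v P.z₁ = 0

variable {P}

namespace InDomain

/-- Green's first identity, with the boundary terms expressed through `f`. When `a₁ = 0` (or
`b₁ = 0`) the function vanishes at that end point, in agreement with `a₀ / 0 = 0`. -/
theorem integral_image_mul_self {f v g : ℝ → ℝ} (h : P.InDomain f v g) :
    ∫ x in P.z₀..P.z₁, g x * f x = (∫ x in P.z₀..P.z₁, P.u x * v x ^ 2)
      + P.u P.z₀ * (P.a₀ / P.a₁) * f P.z₀ ^ 2 + P.u P.z₁ * (P.b₀ / P.b₁) * f P.z₁ ^ 2 := by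
  have hu := P.u_continuousOn
  have hf := h.cont
  have hv := h.cont_deriv
  have hg := h.cont_image
  have hle := P.z₀_lt_z₁.le
  have i1 : IntervalIntegrable (fun x => P.u x * v x ^ 2) MeasureTheory.volume P.z₀ P.z₁ :=
    ContinuousOn.intervalIntegrable_of_Icc hle (by fun_prop)
  have i2 : IntervalIntegrable (fun x => g x * f x) MeasureTheory.volume P.z₀ P.z₁ :=
    ContinuousOn.intervalIntegrable_of_Icc hle (by fun_prop)
  have hftc := intervalIntegral.integral_eq_sub_of_hasDerivAt_of_le
    (f := fun x => P.u x * v x * f x) (f' := fun x => P.u x * v x ^ 2 - g x * f x) hle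
    (by fun_prop)
    (fun x hx => ((h.ode x hx).mul (h.hasDerivAt x hx)).congr_deriv (by ring)) (i1.sub i2)
  rw [intervalIntegral.integral_sub i1 i2] at hftc
  have e0 : v P.z₀ * f P.z₀ = P.a₀ / P.a₁ * f P.z₀ ^ 2 := by
    have hb := h.bc₀
    have hne := P.a_ne
    by_cases h1 : P.a₁ = 0
    · simp only [h1, zero_mul, sub_zero, mul_eq_zero] at hb
      rcases hb with hb | hb
      · simp [h1, hb] at hne
      · simp [hb]
    · field_simp
      linear_combination -f P.z₀ * hb
  have e1 : v P.z₁ * f P.z₁ = -(P.b₀ / P.b₁ * f P.z₁ ^ 2) := by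
    have hb := h.bc₁
    have hne := P.b_ne
    by_cases h1 : P.b₁ = 0
    · simp only [h1, zero_mul, add_zero, mul_eq_zero] at hb
      rcases hb with hb | hb
      · simp [h1, hb] at hne
      · simp [hb]
    · field_simp
      linear_combination f P.z₁ * hb
  linear_combination P.u P.z₀ * e0 - P.u P.z₁ * e1 - hftc

theorem sum {ι : Type*} (s : Finset ι) {f v g : ι → ℝ → ℝ}
    (h : ∀ i, P.InDomain (f i) (v i) (g i)) (c : ι → ℝ) :
    P.InDomain (fun x => ∑ i ∈ s, c i * f i x) (fun x => ∑ i ∈ s, c i * v i x)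
      (fun x => ∑ i ∈ s, c i * g i x) where
  cont := continuousOn_finsetSum _ fun i _ => continuousOn_const.mul (h i).cont
  cont_deriv := continuousOn_finsetSum _ fun i _ => continuousOn_const.mul (h i).cont_deriv
  cont_image := continuousOn_finsetSum _ fun i _ => continuousOn_const.mul (h i).cont_image
  hasDerivAt z hz := HasDerivAt.fun_sum fun i _ => ((h i).hasDerivAt z hz).const_mul (c i)
  ode z hz := by
    have := HasDerivAt.fun_sum (u := s) fun i _ => ((h i).ode z hz).const_mul (c i)
    refine (this.congr_deriv ?_).congr_of_eventuallyEq (Eventually.of_forall fun x => ?_)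
    · simp
    · simp only [Finset.mul_sum]
      exact Finset.sum_congr rfl fun i _ => by ring
  bc₀ := by
    rw [Finset.mul_sum, Finset.mul_sum, ← Finset.sum_sub_distrib]
    exact Finset.sum_eq_zero fun i _ => by linear_combination c i * (h i).bc₀
  bc₁ := by
    rw [Finset.mul_sum, Finset.mul_sum, ← Finset.sum_add_distrib]
    exact Finset.sum_eq_zero fun i _ => by linear_combination c i * (h i).bc₁

/-- Symmetry of the Sturm-Liouville operator (Green's second identity). -/
theorem integral_symm {f₁ v₁ g₁ f₂ v₂ g₂ : ℝ → ℝ} (h₁ : P.InDomain f₁ v₁ g₁)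
    (h₂ : P.InDomain f₂ v₂ g₂) :
    ∫ x in P.z₀..P.z₁, (g₁ x * f₂ x - g₂ x * f₁ x) = 0 := by
  have hu := P.u_continuousOn
  have hf₁ := h₁.cont
  have hv₁ := h₁.cont_deriv
  have hg₁ := h₁.cont_image
  have hf₂ := h₂.cont
  have hv₂ := h₂.cont_deriv
  have hg₂ := h₂.cont_image
  have hle := P.z₀_lt_z₁.le
  rw [intervalIntegral.integral_eq_sub_of_hasDerivAt_of_le
    (f := fun x => P.u x * v₂ x * f₁ x - P.u x * v₁ x * f₂ x) hle (by fun_prop)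
    (fun x hx => (((h₂.ode x hx).mul (h₁.hasDerivAt x hx)).sub
      ((h₁.ode x hx).mul (h₂.hasDerivAt x hx))).congr_deriv (by ring))
    (ContinuousOn.intervalIntegrable_of_Icc hle (by fun_prop))]
  -- at each end point the two Robin conditions are linearly dependent, so the Wronskian vanishes
  have w0 : v₂ P.z₀ * f₁ P.z₀ - v₁ P.z₀ * f₂ P.z₀ = 0 := by
    have hne := P.a_ne
    refine (mul_eq_zero.1 ?_).resolve_left hne.ne'
    linear_combination (P.a₀ * v₂ P.z₀ + P.a₁ * f₂ P.z₀) * h₁.bc₀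
      - (P.a₀ * v₁ P.z₀ + P.a₁ * f₁ P.z₀) * h₂.bc₀
  have w1 : v₂ P.z₁ * f₁ P.z₁ - v₁ P.z₁ * f₂ P.z₁ = 0 := by
    have hne := P.b_ne
    refine (mul_eq_zero.1 ?_).resolve_left hne.ne'
    linear_combination (P.b₀ * v₂ P.z₁ - P.b₁ * f₂ P.z₁) * h₁.bc₁
      - (P.b₀ * v₁ P.z₁ - P.b₁ * f₁ P.z₁) * h₂.bc₁
  linear_combination P.u P.z₁ * w1 - P.u P.z₀ * w0

end InDomain

variable (P)

/-- Coercivity of the energy form, after a shift by `K`, with respect to the sup norm. The boundary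
terms may be negative, and are absorbed by `∫ u f'²` through `sq_le_integral_sq_deriv_add`. -/
theorem exists_sq_le_energy : ∃ C K : ℝ, 0 < C ∧ ∀ f v g : ℝ → ℝ, P.InDomain f v g →
    ∀ z ∈ Icc P.z₀ P.z₁, f z ^ 2 ≤
      C * ((∫ x in P.z₀..P.z₁, g x * f x) + K * ∫ x in P.z₀..P.z₁, f x ^ 2) := by
  have hlt := P.z₀_lt_z₁
  obtain ⟨w, hw, hmin⟩ := isCompact_Icc.exists_isMinOn (nonempty_Icc.2 hlt.le) P.u_continuousOn
  set m := P.u w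
  have hm : 0 < m := P.u_pos w hw
  set κ₀ := |P.u P.z₀ * (P.a₀ / P.a₁)|
  set κ₁ := |P.u P.z₁ * (P.b₀ / P.b₁)|
  have hκ₀ : 0 ≤ κ₀ := abs_nonneg _
  have hκ₁ : 0 ≤ κ₁ := abs_nonneg _
  -- with this `ε` the boundary terms cost at most half of `m * ∫ v²`
  set ε := m / (2 * (κ₀ + κ₁ + 1)) with hεdef
  have hε : 0 < ε := by positivity
  have hεm : 2 * (κ₀ + κ₁ + 1) * ε = m := by rw [hεdef]; field_simp
  set c := 1 / ε + 1 / (P.z₁ - P.z₀)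
  refine ⟨1 / (κ₀ + κ₁ + 1), (2 * (κ₀ + κ₁) + 1) * c, by positivity, fun f v g h z hz => ?_⟩
  have hu := P.u_continuousOn
  have hv := h.cont_deriv
  have hint := fun {x} hx =>
    sq_le_integral_sq_deriv_add (z := x) hlt h.cont h.cont_deriv h.hasDerivAt hε hx
  have h0 := hint (left_mem_Icc.2 hlt.le)
  have h1 := hint (right_mem_Icc.2 hlt.le)
  have hz' := hint hz
  have hE : m * (∫ x in P.z₀..P.z₁, v x ^ 2) ≤ ∫ x in P.z₀..P.z₁, P.u x * v x ^ 2 := by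
    rw [← intervalIntegral.integral_const_mul]
    refine intervalIntegral.integral_mono_on hlt.le
      (ContinuousOn.intervalIntegrable_of_Icc hlt.le (by fun_prop))
      (ContinuousOn.intervalIntegrable_of_Icc hlt.le (by fun_prop)) fun x hx => ?_
    exact mul_le_mul_of_nonneg_right (hmin hx) (sq_nonneg _)
  rw [h.integral_image_mul_self]
  set V := ∫ x in P.z₀..P.z₁, v x ^ 2
  set N := ∫ x in P.z₀..P.z₁, f x ^ 2
  have b0 : -(κ₀ * (ε * V + c * N)) ≤ P.u P.z₀ * (P.a₀ / P.a₁) * f P.z₀ ^ 2 := by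
    have s1 := mul_le_mul_of_nonneg_left h0 hκ₀
    have s2 := mul_le_mul_of_nonneg_right (neg_abs_le (P.u P.z₀ * (P.a₀ / P.a₁)))
      (sq_nonneg (f P.z₀))
    linarith
  have b1 : -(κ₁ * (ε * V + c * N)) ≤ P.u P.z₁ * (P.b₀ / P.b₁) * f P.z₁ ^ 2 := by
    have s1 := mul_le_mul_of_nonneg_left h1 hκ₁
    have s2 := mul_le_mul_of_nonneg_right (neg_abs_le (P.u P.z₁ * (P.b₀ / P.b₁)))
      (sq_nonneg (f P.z₁))
    linarith
  have hV : 0 ≤ ε * V :=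
    mul_nonneg hε.le (intervalIntegral.integral_nonneg hlt.le fun x _ => sq_nonneg _)
  have s := mul_le_mul_of_nonneg_left hz' (by positivity : 0 ≤ κ₀ + κ₁ + 1)
  rw [one_div, ← div_eq_inv_mul, le_div_iff₀ (by positivity)]
  rw [← hεm] at hE
  linarith

variable {P}

/-! ### Eigenfunctions: orthogonality and the Bessel inequality for point evaluation -/

theorem IsEigenfunction.inDomain {μ : ℝ} {y : ℝ → ℝ} (h : P.IsEigenfunction μ y) :
    P.InDomain y (P.D y) (fun x => μ * y x) where
  cont := h.contDiffOn.continuousOn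
  cont_deriv := h.contDiffOn.continuousOn_derivWithin (uniqueDiffOn_Icc P.z₀_lt_z₁) le_rfl
  cont_image := continuousOn_const.mul h.contDiffOn.continuousOn
  hasDerivAt z hz :=
    ((h.contDiffOn.differentiableOn one_ne_zero z
      (Ioo_subset_Icc_self hz)).hasDerivWithinAt).hasDerivAt (Icc_mem_nhds hz.1 hz.2)
  ode := h.ode
  bc₀ := h.bc₀
  bc₁ := h.bc₁

theorem IsEigenfunction.continuousOn {μ : ℝ} {y : ℝ → ℝ} (h : P.IsEigenfunction μ y) :
    ContinuousOn y (Icc P.z₀ P.z₁) :=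
  h.contDiffOn.continuousOn

theorem IsEigenfunction.integral_sq_pos {μ : ℝ} {y : ℝ → ℝ} (h : P.IsEigenfunction μ y) :
    0 < ∫ x in P.z₀..P.z₁, y x ^ 2 := by
  obtain ⟨z, hz, hne⟩ := h.nontrivial
  have hc := h.continuousOn
  exact intervalIntegral.integral_pos P.z₀_lt_z₁ (by fun_prop) (fun x _ => sq_nonneg _)
    ⟨z, hz, by positivity⟩

theorem IsEigenfunction.integral_mul_eq_zero {μ₁ μ₂ : ℝ} {y₁ y₂ : ℝ → ℝ}
    (h₁ : P.IsEigenfunction μ₁ y₁) (h₂ : P.IsEigenfunction μ₂ y₂) (hne : μ₁ ≠ μ₂) :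
    ∫ x in P.z₀..P.z₁, y₁ x * y₂ x = 0 := by
  have h := h₁.inDomain.integral_symm h₂.inDomain
  have e : (fun x => μ₁ * y₁ x * y₂ x - μ₂ * y₂ x * y₁ x)
      = fun x => (μ₁ - μ₂) * (y₁ x * y₂ x) := by
    ext x; ring
  rw [e, intervalIntegral.integral_const_mul] at h
  exact (mul_eq_zero.1 h).resolve_left (sub_ne_zero.2 hne)

namespace IsEigensystem

variable {lam : ℕ → ℝ} {y : ℕ → ℝ → ℝ}

theorem integral_sum_mul_sum (hy : P.IsEigensystem lam y) (s : Finset ℕ) (p q : ℕ → ℝ) :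
    ∫ x in P.z₀..P.z₁, (∑ i ∈ s, p i * y i x) * (∑ j ∈ s, q j * y j x)
      = ∑ i ∈ s, p i * q i * ∫ x in P.z₀..P.z₁, y i x ^ 2 := by
  have hc := fun i => (hy.eigen i).continuousOn
  have hii : ∀ i j, IntervalIntegrable (fun x => p i * q j * (y i x * y j x))
      MeasureTheory.volume P.z₀ P.z₁ := fun i j =>
    ContinuousOn.intervalIntegrable_of_Icc P.z₀_lt_z₁.le
      (continuousOn_const.mul ((hc i).mul (hc j)))
  have e : (fun x => (∑ i ∈ s, p i * y i x) * (∑ j ∈ s, q j * y j x))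
      = fun x => ∑ i ∈ s, ∑ j ∈ s, p i * q j * (y i x * y j x) := by
    ext x
    rw [Finset.sum_mul_sum]
    exact Finset.sum_congr rfl fun i _ => Finset.sum_congr rfl fun j _ => by ring
  rw [e, intervalIntegral.integral_finsetSum fun i _ => by
    simpa only [Finset.sum_fn] using IntervalIntegrable.sum s fun j _ => hii i j]
  refine Finset.sum_congr rfl fun i hi => ?_
  rw [intervalIntegral.integral_finsetSum fun j _ => hii i j, Finset.sum_eq_single i]
  · rw [intervalIntegral.integral_const_mul]
    simp only [sq]
  · intro j _ hji
    rw [intervalIntegral.integral_const_mul,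
      (hy.eigen i).integral_mul_eq_zero (hy.eigen j) (hy.strictMono.injective.ne hji.symm),
      mul_zero]
  · exact fun h => absurd hi h

/-- A Bessel inequality for point evaluation in the energy norm. Coercivity bounds `f z ^ 2` by
`C * ∑ (lam n + K) * c n ^ 2 * ∫ y n ^ 2` for `f = ∑ c n * y n`; the Riesz coefficients
`c n = y n z / ((lam n + K) * ∫ y n ^ 2)` make that sum equal to `f z`, so `f z ≤ C`. -/
theorem exists_sum_sq_div_le (hy : P.IsEigensystem lam y) : ∃ C K : ℝ, 0 < C ∧
    (∀ n, 0 < lam n + K) ∧ ∀ (s : Finset ℕ), ∀ z ∈ Icc P.z₀ P.z₁,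
      ∑ n ∈ s, y n z ^ 2 / ((lam n + K) * ∫ x in P.z₀..P.z₁, y n x ^ 2) ≤ C := by
  obtain ⟨C, K, hC, hCK⟩ := P.exists_sq_le_energy
  have hN := fun n => (hy.eigen n).integral_sq_pos
  have hpos : ∀ n, 0 < lam n + K := by
    intro n
    obtain ⟨z, hz, hne⟩ := (hy.eigen n).nontrivial
    have h := hCK _ _ _ (hy.eigen n).inDomain z hz
    have e : (fun x => lam n * y n x * y n x) = fun x => lam n * y n x ^ 2 := by
      ext x; ring
    rw [e, intervalIntegral.integral_const_mul, ← add_mul] at h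
    have h1 : 0 < C * ((lam n + K) * ∫ x in P.z₀..P.z₁, y n x ^ 2) :=
      lt_of_lt_of_le (by positivity) h
    exact pos_of_mul_pos_left (pos_of_mul_pos_right h1 hC.le) (hN n).le
  refine ⟨C, K, hC, hpos, fun s z hz => ?_⟩
  set N : ℕ → ℝ := fun n => ∫ x in P.z₀..P.z₁, y n x ^ 2
  set c : ℕ → ℝ := fun n => y n z / ((lam n + K) * N n) with hc
  have h := hCK _ _ _ (InDomain.sum s (fun n => (hy.eigen n).inDomain) c) z hz
  have e1 := hy.integral_sum_mul_sum s (fun n => c n * lam n) c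
  have e2 := hy.integral_sum_mul_sum s c c
  simp only [mul_assoc] at e1
  simp only [← sq] at e2
  have hsum : ∑ n ∈ s, c n * y n z = ∑ n ∈ s, y n z ^ 2 / ((lam n + K) * N n) :=
    Finset.sum_congr rfl fun n _ => by simp only [hc]; ring
  have henergy : (∑ n ∈ s, c n * (lam n * (c n * N n))) + K * ∑ n ∈ s, c n ^ 2 * N n
      = ∑ n ∈ s, y n z ^ 2 / ((lam n + K) * N n) := by
    rw [Finset.mul_sum, ← Finset.sum_add_distrib]
    refine Finset.sum_congr rfl fun n _ => ?_
    have := (hpos n).ne'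
    have := (hN n).ne'
    simp only [hc, N]
    field_simp
  rw [e1, e2, henergy, hsum] at h
  set S := ∑ n ∈ s, y n z ^ 2 / ((lam n + K) * N n)
  by_contra! hlt
  nlinarith

/-- The terms of the series are dominated, uniformly in `z`, by `M * (lam n + K)`, and the shifted
eigenvalues have summable inverses. -/
theorem exists_bound (hy : P.IsEigensystem lam y) {θbar : ℝ → ℝ}
    (hθ : ContinuousOn θbar (Icc P.z₀ P.z₁)) :
    ∃ M K : ℝ, (∀ n, 0 < lam n + K) ∧ Summable (fun n => (lam n + K)⁻¹) ∧
      ∀ n, ∀ z ∈ Icc P.z₀ P.z₁, |P.coeff θbar (y n) * y n z| ≤ M * (lam n + K) := by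
  obtain ⟨C, K, hC, hpos, hS⟩ := hy.exists_sum_sq_div_le
  have hle := P.z₀_lt_z₁.le
  have hN := fun n => (hy.eigen n).integral_sq_pos
  have hh : IntervalIntegrable (fun x => P.ψ x - θbar x) MeasureTheory.volume P.z₀ P.z₁ :=
    ((intervalIntegrable_iff_integrableOn_Ioo_of_le hle).2 P.ψ_integrable).sub
      (ContinuousOn.intervalIntegrable_of_Icc hle hθ)
  set J := ∫ x in P.z₀..P.z₁, |P.ψ x - θbar x|
  have hJ : 0 ≤ J := intervalIntegral.integral_nonneg hle fun x _ => abs_nonneg _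
  refine ⟨J * C, K, hpos, ?_, fun n z hz => ?_⟩
  · -- integrate the Bessel inequality over `[z₀, z₁]`
    refine summable_of_sum_le (c := (P.z₁ - P.z₀) * C) (fun n => (inv_pos.2 (hpos n)).le)
      fun s => ?_
    have hi : ∀ n ∈ s, IntervalIntegrable
        (fun z => y n z ^ 2 / ((lam n + K) * ∫ x in P.z₀..P.z₁, y n x ^ 2))
        MeasureTheory.volume P.z₀ P.z₁ := fun n _ =>
      ContinuousOn.intervalIntegrable_of_Icc hle
        (((hy.eigen n).continuousOn.pow 2).div_const _)
    have h := intervalIntegral.integral_mono_on hle (IntervalIntegrable.sum s hi)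
      (intervalIntegrable_const (c := C)) (fun z hz => by simpa using hS s z hz)
    simp only [Finset.sum_apply] at h
    rw [intervalIntegral.integral_const, smul_eq_mul, intervalIntegral.integral_finsetSum hi] at h
    refine le_trans (le_of_eq (Finset.sum_congr rfl fun n _ => ?_)) h
    rw [intervalIntegral.integral_div]
    have := (hN n).ne'
    have := (hpos n).ne'
    field_simp
  · set N := ∫ x in P.z₀..P.z₁, y n x ^ 2 with hNdef
    have hNn : 0 < N := hN n
    set R := √(C * ((lam n + K) * N))
    have hR : R * R = C * ((lam n + K) * N) :=
      Real.mul_self_sqrt (mul_pos hC (mul_pos (hpos n) hNn)).le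
    have hsup : ∀ x ∈ Icc P.z₀ P.z₁, |y n x| ≤ R := fun x hx => by
      refine Real.abs_le_sqrt ?_
      have h := hS {n} x hx
      rw [Finset.sum_singleton, div_le_iff₀ (mul_pos (hpos n) (hN n))] at h
      exact h
    have hI : |∫ x in P.z₀..P.z₁, (P.ψ x - θbar x) * y n x| ≤ J * R := by
      rw [← intervalIntegral.integral_mul_const, ← Real.norm_eq_abs]
      refine intervalIntegral.norm_integral_le_of_norm_le hle
        (Eventually.of_forall fun x hx => ?_) (hh.abs.mul_const R)
      rw [Real.norm_eq_abs, abs_mul]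
      exact mul_le_mul_of_nonneg_left (hsup x (Ioc_subset_Icc_self hx)) (abs_nonneg _)
    rw [coeff, ← hNdef, div_mul_eq_mul_div, abs_div, abs_of_pos hNn, div_le_iff₀ hNn, abs_mul]
    calc _ ≤ J * R * R := mul_le_mul hI (hsup z hz) (abs_nonneg _) (by positivity)
      _ = J * C * (lam n + K) * N := by rw [mul_assoc, hR]; ring

/-! ### Majorants of the series -/

/-- A majorant `b` of the coefficients of the series, independent of `z`, which stays summable
against the decaying exponentials. -/
theorem exists_majorant (hy : P.IsEigensystem lam y) {θbar : ℝ → ℝ}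
    (hθ : ContinuousOn θbar (Icc P.z₀ P.z₁)) :
    ∃ b : ℕ → ℝ, (∀ n, ∀ z ∈ Icc P.z₀ P.z₁, |P.coeff θbar (y n) * y n z| ≤ b n) ∧
      ∀ τ : ℝ, 0 < τ → Summable (fun n => b n * Real.exp (-(lam n * τ))) := by
  obtain ⟨M, K, hpos, hsum, hb⟩ := hy.exists_bound hθ
  refine ⟨fun n => M * (lam n + K), hb, fun τ hτ => ?_⟩
  simp only [mul_assoc]
  refine Summable.mul_left M (Summable.of_nonneg_of_le
    (fun n => mul_nonneg (hpos n).le (Real.exp_nonneg _)) (fun n => ?_)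
    (hsum.mul_left (2 / τ ^ 2 * Real.exp (K * τ))))
  set x := lam n + K with hx
  have hx0 : 0 < x := hpos n
  have e : Real.exp (-(lam n * τ)) = Real.exp (K * τ) / Real.exp (x * τ) := by
    rw [← Real.exp_sub]
    congr 1
    rw [hx]
    ring
  -- `x² exp (-x τ)` is bounded because `exp s ≥ s² / 2`
  have hq : (x * τ) ^ 2 / 2 ≤ Real.exp (x * τ) := by
    have := Real.quadratic_le_exp_of_nonneg (mul_pos hx0 hτ).le
    have := mul_pos hx0 hτ
    linarith
  have hK := Real.exp_pos (K * τ)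
  rw [e, ← mul_div_assoc, div_le_iff₀ (Real.exp_pos _)]
  calc x * Real.exp (K * τ)
      = 2 / τ ^ 2 * Real.exp (K * τ) * x⁻¹ * ((x * τ) ^ 2 / 2) := by field_simp
    _ ≤ _ := by gcongr

/-- The tail of the series after the first `k` terms decays like `exp (-(lam k * t))`. -/
theorem exists_tail_le (hy : P.IsEigensystem lam y) {θbar : ℝ → ℝ}
    (hθ : ContinuousOn θbar (Icc P.z₀ P.z₁)) (k : ℕ) {t₀ : ℝ} (ht₀ : 0 < t₀) :
    ∃ C : ℝ, ∀ t : ℝ, t₀ ≤ t → ∀ z ∈ Icc P.z₀ P.z₁,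
      |P.theta θbar lam y z t - (θbar z + ∑ n ∈ Finset.range k, P.term θbar lam y n z t)| ≤
        C * Real.exp (-(lam k * t)) := by
  obtain ⟨b, hb, hs⟩ := hy.exists_majorant hθ
  refine ⟨(∑' n, b (n + k) * Real.exp (-(lam (n + k) * t₀))) * Real.exp (lam k * t₀),
    fun t ht z hz => ?_⟩
  have hbt : ∀ n, ‖P.term θbar lam y n z t‖ ≤ b n * Real.exp (-(lam n * t)) := fun n => by
    rw [term, norm_mul, Real.norm_eq_abs, Real.norm_of_nonneg (Real.exp_nonneg _)]
    exact mul_le_mul_of_nonneg_right (hb n z hz) (Real.exp_nonneg _)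
  have hst : Summable (fun n => P.term θbar lam y n z t) :=
    Summable.of_norm_bounded (hs t (ht₀.trans_le ht)) hbt
  rw [theta, ← hst.sum_add_tsum_nat_add k, add_sub_add_left_eq_sub, add_sub_cancel_left,
    mul_assoc, ← tsum_mul_right, ← Real.norm_eq_abs]
  refine tsum_of_norm_bounded (((summable_nat_add_iff k).2 (hs t₀ ht₀)).mul_right _).hasSum
    fun n => (hbt (n + k)).trans ?_
  rw [mul_assoc, ← Real.exp_add, ← Real.exp_add]
  refine mul_le_mul_of_nonneg_left (Real.exp_le_exp.2 ?_)
    ((abs_nonneg _).trans (hb (n + k) z hz))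
  have hmono : lam k ≤ lam (n + k) := hy.strictMono.monotone (Nat.le_add_left k n)
  nlinarith

end IsEigensystem

end DiffusionIBVP

/-! ### Convergence and large-time behaviour of the series solution -/

theorem mainTheorem3 (P : DiffusionIBVP) (θbar : ℝ → ℝ) (hθbar : P.IsSteadyState θbar)
    (lam : ℕ → ℝ) (y : ℕ → ℝ → ℝ) (hy : P.IsEigensystem lam y) :
    -- convergence to the steady state when all the eigenvalues are positive
    ((∀ n, 0 < lam n) →
      ∀ z ∈ Icc P.z₀ P.z₁, Tendsto (fun t => P.theta θbar lam y z t) atTop (𝓝 (θbar z))) ∧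
    -- uniform convergence of the series at each positive time, and continuity of its sum
    (∀ τ : ℝ, 0 < τ →
      (∀ z ∈ Icc P.z₀ P.z₁, Summable (fun n => P.term θbar lam y n z τ)) ∧
      TendstoUniformlyOn
        (fun (N : ℕ) (z : ℝ) => θbar z + ∑ n ∈ Finset.range N, P.term θbar lam y n z τ)
        (fun z => P.theta θbar lam y z τ) atTop (Icc P.z₀ P.z₁) ∧
      ContinuousOn (fun z => P.theta θbar lam y z τ) (Icc P.z₀ P.z₁)) ∧
    -- approximation for large times by the term of the lowest eigenvalue, uniformly in `z`
    (∀ t₀ : ℝ, 0 < t₀ → ∃ C : ℝ, ∀ t : ℝ, t₀ ≤ t → ∀ z ∈ Icc P.z₀ P.z₁,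
      |P.theta θbar lam y z t -
          (θbar z + P.coeff θbar (y 0) * y 0 z * Real.exp (-(lam 0 * t)))| ≤
        C * Real.exp (-(lam 1 * t))) ∧
    TendstoUniformlyOn
      (fun (t z : ℝ) => Real.exp (lam 0 * t) * (P.theta θbar lam y z t - θbar z))
      (fun z => P.coeff θbar (y 0) * y 0 z) atTop (Icc P.z₀ P.z₁) := by
  have hθ : ContinuousOn θbar (Icc P.z₀ P.z₁) := hθbar.contDiffOn.continuousOn
  have hexp : ∀ c : ℝ, 0 < c → ∀ C : ℝ,
      Tendsto (fun t : ℝ => C * Real.exp (-(c * t))) atTop (𝓝 0) := fun c hc C => by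
    simpa using (Real.tendsto_exp_neg_atTop_nhds_zero.comp
      (tendsto_id.const_mul_atTop hc)).const_mul C
  refine ⟨fun hpos z hz => ?_, fun τ hτ => ?_, fun t₀ ht₀ => ?_, ?_⟩
  · obtain ⟨C, hC⟩ := hy.exists_tail_le hθ 0 one_pos
    rw [tendsto_iff_norm_sub_tendsto_zero]
    refine squeeze_zero' (Eventually.of_forall fun t => norm_nonneg _) ?_
      (hexp (lam 0) (hpos 0) C)
    filter_upwards [eventually_ge_atTop 1] with t ht
    simpa using hC t ht z hz
  · obtain ⟨b, hb, hs⟩ := hy.exists_majorant hθ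
    have hbt : ∀ n, ∀ z ∈ Icc P.z₀ P.z₁,
        ‖P.term θbar lam y n z τ‖ ≤ b n * Real.exp (-(lam n * τ)) := fun n z hz => by
      rw [DiffusionIBVP.term, norm_mul, Real.norm_eq_abs,
        Real.norm_of_nonneg (Real.exp_nonneg _)]
      exact mul_le_mul_of_nonneg_right (hb n z hz) (Real.exp_nonneg _)
    refine ⟨fun z hz => Summable.of_norm_bounded (hs τ hτ) fun n => hbt n z hz, ?_, ?_⟩
    · have h := tendstoUniformlyOn_tsum_nat (hs τ hτ) hbt
      rw [Metric.tendstoUniformlyOn_iff] at h ⊢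
      simpa only [DiffusionIBVP.theta, dist_add_left] using h
    · exact hθ.add (continuousOn_tsum
        (fun n => (continuousOn_const.mul (hy.eigen n).continuousOn).mul continuousOn_const)
        (hs τ hτ) hbt)
  · obtain ⟨C, hC⟩ := hy.exists_tail_le hθ 1 ht₀
    exact ⟨C, fun t ht z hz => by simpa [DiffusionIBVP.term] using hC t ht z hz⟩
  · obtain ⟨C, hC⟩ := hy.exists_tail_le hθ 1 one_pos
    rw [Metric.tendstoUniformlyOn_iff]
    intro ε hε
    have hgap : 0 < lam 1 - lam 0 := sub_pos.2 (hy.strictMono one_pos)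
    filter_upwards [eventually_ge_atTop 1, (hexp _ hgap C).eventually_lt_const hε]
      with t ht hlt z hz
    have h := hC t ht z hz
    simp only [Finset.sum_range_one, DiffusionIBVP.term] at h
    have h1 : Real.exp (lam 0 * t) * Real.exp (-(lam 0 * t)) = 1 := by
      rw [← Real.exp_add, add_neg_cancel, Real.exp_zero]
    have e : Real.exp (lam 0 * t) * (P.theta θbar lam y z t - θbar z)
        - P.coeff θbar (y 0) * y 0 z
        = Real.exp (lam 0 * t) * (P.theta θbar lam y z t -
          (θbar z + P.coeff θbar (y 0) * y 0 z * Real.exp (-(lam 0 * t)))) := by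
      linear_combination (P.coeff θbar (y 0) * y 0 z) * h1
    rw [dist_comm, Real.dist_eq, e, abs_mul, abs_of_pos (Real.exp_pos _)]
    refine (mul_le_mul_of_nonneg_left h (Real.exp_nonneg _)).trans_lt (lt_of_eq_of_lt ?_ hlt)
    rw [mul_left_comm, ← Real.exp_add]
    congr 2
    ring
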